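/- Let $n,p,d\ge 1$ be integers with $5d\le p$. Let $\mathbf X\in\mathbf R^{n\times p}$ be deterministic, let $\beta^*\in\mathbf R^p$ be arbitrary (no sparsity assumption), and let $y=\mathbf X\beta^*+\varepsilon$ with $\varepsilon\sim N(0,\sigma^2 I_{n\times n})$, $\sigma>0$. Let $\lambda\ge 0$ and let $\hat\beta$ be a Lasso estimator, that is, almost surely $$\hat\beta\in\operatorname*{argmin}_{\beta\in\mathbf R^p}\ \|\mathbf X\beta-y\|^2+2\sqrt n\,\lambda\|\beta\|_1 ,$$ where $\|\cdot\|$ is the Euclidean norm. For a positive integer $s$, let $\delta_s$ be the smallest $\delta\ge 0$ such that $$(1-\delta)\|\beta\|\le \tfrac1{\sqrt n}\|\mathbf X\beta\|\le(1+\delta)\|\beta\|\qquad\text{for all }\beta\in\mathbf R^p\text{ with at most } s \text{ nonzero coordinates.}$$ If $$\lambda\le\frac{1-\delta_{2d}}{8}\,\sigma\sqrt{\log\big(p/(5d)\big)},$$ then the prediction error $\|\mathbf X(\hat\beta-\beta^*)\|$ is integrable and $$\frac{1-\delta_{2d}}{8(1+\delta_d)}\,\sigma\sqrt{d\log\big(p/(5d)\big)}\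 \le\ \mathbb E\,\|\mathbf X(\hat\beta-\beta^*)\| .$$ -/

import Mathlib

open MeasureTheory ProbabilityTheory

noncomputable section

/-- `|β|₀`, the number of nonzero coordinates of `β`. -/
def sparsity {p : ℕ} (β : EuclideanSpace ℝ (Fin p)) : ℕ :=
  (Finset.univ.filter fun j => β j ≠ 0).card

/-- The real numbers `δ ≥ 0` such that
`(1 - δ) ‖β‖ ≤ (1/√n) ‖Xβ‖ ≤ (1 + δ) ‖β‖` for every `β` with `|β|₀ ≤ s`. -/
def ripSet {n p : ℕ} (X : Matrix (Fin n) (Fin p) ℝ) (s : ℕ) : Set ℝ :=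
  {δ | 0 ≤ δ ∧ ∀ β : EuclideanSpace ℝ (Fin p), sparsity β ≤ s →
    (1 - δ) * ‖β‖ ≤ (1 / √(n : ℝ)) * ‖X.toEuclideanLin β‖ ∧
    (1 / √(n : ℝ)) * ‖X.toEuclideanLin β‖ ≤ (1 + δ) * ‖β‖}

/-- The restricted isometry constant `δ_s` of the matrix `X`: the smallest element of `ripSet X s`
(see `isLeast_ripConstant`). -/
def ripConstant {n p : ℕ} (X : Matrix (Fin n) (Fin p) ℝ) (s : ℕ) : ℝ :=
  sInf (ripSet X s)

/-- The smallest element in the definition of the restricted isometry constant exists. -/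
theorem isLeast_ripConstant {n p : ℕ} (X : Matrix (Fin n) (Fin p) ℝ) (s : ℕ) :
    IsLeast (ripSet X s) (ripConstant X s) := by
  have hbdd : BddBelow (ripSet X s) := ⟨0, fun δ hδ => hδ.1⟩
  have hne : (ripSet X s).Nonempty := by
    let L := LinearMap.toContinuousLinearMap X.toEuclideanLin
    have hr : 0 ≤ 1 / √(n : ℝ) := by positivity
    have hC : 0 ≤ (1 / √(n : ℝ)) * ‖L‖ := by positivity
    refine ⟨1 + (1 / √(n : ℝ)) * ‖L‖, by positivity, fun β _ => ⟨?_, ?_⟩⟩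
    · have h1 : 0 ≤ (1 / √(n : ℝ)) * ‖X.toEuclideanLin β‖ := by positivity
      have h2 : 0 ≤ ((1 / √(n : ℝ)) * ‖L‖) * ‖β‖ := by positivity
      linarith
    · have h1 : ‖X.toEuclideanLin β‖ ≤ ‖L‖ * ‖β‖ := L.le_opNorm β
      have h2 := mul_le_mul_of_nonneg_left h1 hr
      have h3 : 0 ≤ ‖β‖ := norm_nonneg β
      nlinarith
  have hcl : IsClosed (ripSet X s) := by
    have : ripSet X s = Set.Ici 0 ∩ ⋂ (β : EuclideanSpace ℝ (Fin p)) (_ : sparsity β ≤ s),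
        ({δ : ℝ | (1 - δ) * ‖β‖ ≤ (1 / √(n : ℝ)) * ‖X.toEuclideanLin β‖} ∩
          {δ : ℝ | (1 / √(n : ℝ)) * ‖X.toEuclideanLin β‖ ≤ (1 + δ) * ‖β‖}) := by
      ext δ
      simp [ripSet]
    rw [this]
    refine isClosed_Ici.inter (isClosed_iInter fun β => isClosed_iInter fun _ => ?_)
    exact (isClosed_le (by fun_prop) (by fun_prop)).inter
      (isClosed_le (by fun_prop) (by fun_prop))
  exact ⟨hcl.csInf_mem hne hbdd, fun δ hδ => csInf_le hbdd hδ⟩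

/-- The Lasso penalty `h(β) = √n λ ‖β‖₁`. -/
def lassoPenalty {p : ℕ} (n : ℕ) (lam : ℝ) (β : EuclideanSpace ℝ (Fin p)) : ℝ :=
  √(n : ℝ) * lam * ∑ j, |β j|

/-- `b ∈ argmin_β ‖Xβ - y‖² + 2 h(β)`. -/
def IsPenalizedLeastSquares {n p : ℕ} (X : Matrix (Fin n) (Fin p) ℝ)
    (h : EuclideanSpace ℝ (Fin p) → ℝ) (y : EuclideanSpace ℝ (Fin n))
    (b : EuclideanSpace ℝ (Fin p)) : Prop :=
  ∀ β : EuclideanSpace ℝ (Fin p),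
    ‖X.toEuclideanLin b - y‖ ^ 2 + 2 * h b ≤ ‖X.toEuclideanLin β - y‖ ^ 2 + 2 * h β

end

/-! Optimality of the estimator against the perturbation `βhat + u` bounds `⟪ε, X u⟫ - h u` by `‖X
u‖` times the prediction error, for every `u`, even one depending on the noise. Take `d` disjoint
blocks of `m = ⌊p/d⌋` columns and let `u` be the 0-1 vector selecting in each block the column most
correlated with `ε`. Then `⟪ε, X u⟫` is a sum of `d` Gaussian maxima, the penalty is `√n λ d`, and
`‖X u‖ ≤ √n (1 + δ_d) √d`. Distinct columns are at distance at least `√(2n) (1 - δ_{2d})`, so a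
Sudakov bound (`IsGaussian.le_integral_sup'_inner`) makes each expected maximum at least `σ √n (1 -
δ_{2d}) √(log (p/(5d))) / 4`; the assumption on `λ` lets the penalty use up at most half of this.

The Sudakov bound uses no Gaussian comparison. The maximum dominates the softmax average `A`.
Stein's identity turns `A` into an expected variance, large unless the weights concentrate; an
entropy inequality makes `A` large when they do. With the right inverse temperature, adding the two
bounds cancels the concentration term. -/

open scoped NNReal RealInnerProductSpace

/-! ### Gaussian integration by parts, on the line and in a Euclidean space -/

/-- Gaussian integration by parts on the real line. -/
theorem integral_id_mul_gaussianReal {w : ℝ≥0} (hw : w ≠ 0) {g g' : ℝ → ℝ} {C C' : ℝ}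
    (hg : ∀ t, HasDerivAt g (g' t) t) (hC : ∀ t, |g t| ≤ C) (hC' : ∀ t, |g' t| ≤ C') :
    ∫ t, t * g t ∂gaussianReal 0 w = w * ∫ t, g' t ∂gaussianReal 0 w := by
  have hw' : (w : ℝ) ≠ 0 := by exact_mod_cast hw
  have hgc : Continuous g := continuous_iff_continuousAt.2 fun t => (hg t).continuousAt
  have hg'm : Measurable g' := by
    rw [show g' = deriv g from funext fun t => (hg t).deriv.symm]
    exact measurable_deriv g
  have hpdf (t : ℝ) : HasDerivAt (gaussianPDFReal 0 w) (-(t / w) * gaussianPDFReal 0 w t) t := by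
    have h1 : HasDerivAt (fun t : ℝ => -(t - 0) ^ 2 / (2 * (w : ℝ))) (-(t / w)) t := by
      have := (((hasDerivAt_id t).sub_const (0 : ℝ)).pow 2).neg.div_const (2 * (w : ℝ))
      refine this.congr_deriv ?_
      simp
      field_simp
    have := (h1.exp).const_mul ((√(2 * Real.pi * w))⁻¹)
    rw [gaussianPDFReal_def]
    refine this.congr_deriv ?_
    ring
  have hid : Integrable (fun t : ℝ => gaussianPDFReal 0 w t * t) := by
    have h : Integrable (fun t : ℝ => t) (gaussianReal 0 w) := IsGaussian.integrable_fun_id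
    rw [gaussianReal_of_var_ne_zero _ hw, gaussianPDF_def,
      integrable_withDensity_iff_integrable_smul₀' (by fun_prop) (by simp)] at h
    refine h.congr (ae_of_all _ fun t => ?_)
    simp [gaussianPDFReal_nonneg]
  -- The Gaussian density `φ` satisfies `φ' = -(t/w) φ`, so Stein's identity is integration by parts
  -- of `g` against `φ'`.
  have key := integral_mul_deriv_eq_deriv_mul_of_integrable (u := g) (u' := g')
    (v := gaussianPDFReal 0 w) (v' := fun t => -(t / w) * gaussianPDFReal 0 w t)
    (fun t _ => hg t) (fun t _ => hpdf t) ?_ ?_ ?_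
  · rw [integral_gaussianReal_eq_integral_smul hw, integral_gaussianReal_eq_integral_smul hw]
    have e1 : ∫ t, gaussianPDFReal 0 w t • (t * g t)
        = -(w : ℝ) * ∫ t, g t * (-(t / w) * gaussianPDFReal 0 w t) := by
      rw [← integral_const_mul]
      congr 1 with t
      simp only [smul_eq_mul]
      field_simp
    rw [e1, key]
    simp [mul_comm]
  · refine ((hid.bdd_mul (c := C) hgc.aestronglyMeasurable (ae_of_all _ hC)).const_mul
      (-(w : ℝ)⁻¹)).congr (ae_of_all _ fun t => ?_)
    simp only [Pi.mul_apply]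
    ring
  · exact (integrable_gaussianPDFReal 0 w).bdd_mul (c := C') hg'm.aestronglyMeasurable
      (ae_of_all _ hC')
  · exact (integrable_gaussianPDFReal 0 w).bdd_mul (c := C) hgc.aestronglyMeasurable
      (ae_of_all _ hC)

section Stein

variable {E : Type*} [NormedAddCommGroup E] [InnerProductSpace ℝ E] [FiniteDimensional ℝ E]
  [MeasurableSpace E] [BorelSpace E] {μ : Measure E} [IsGaussian μ] {s : ℝ}

theorem IsGaussian.covariance_inner_inner (hcov : ∀ x y, covarianceBilin μ x y = s * ⟪x, y⟫)
    (u v : E) : cov[fun x => ⟪u, x⟫, fun x => ⟪v, x⟫; μ] = s * ⟪u, v⟫ := by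
  rw [← hcov, covarianceBilin_apply_eq_cov IsGaussian.memLp_two_id]

theorem IsGaussian.integral_inner_eq_zero (hmean : ∫ x, x ∂μ = 0) (v : E) :
    ∫ x, ⟪v, x⟫ ∂μ = 0 := by
  rw [integral_inner IsGaussian.integrable_fun_id, hmean, inner_zero_right]

theorem IsGaussian.map_inner_eq_gaussianReal (hmean : ∫ x, x ∂μ = 0)
    (hcov : ∀ x y, covarianceBilin μ x y = s * ⟪x, y⟫) (v : E) :
    μ.map (fun x => ⟪v, x⟫) = gaussianReal 0 (s * ‖v‖ ^ 2).toNNReal := by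
  have h := IsGaussian.map_eq_gaussianReal (μ := μ) (innerSL ℝ v)
  have hv : Var[fun x => ⟪v, x⟫; μ] = s * ‖v‖ ^ 2 := by
    rw [← covariance_self (by fun_prop), covariance_inner_inner hcov, real_inner_self_eq_norm_sq]
  simp only [innerSL_apply_apply] at h
  rw [integral_inner_eq_zero hmean] at h
  rw [← hv]
  exact h

/-- The two maps are jointly Gaussian, being linear in `x`, and uncorrelated because the covariance
is isotropic and the residual is orthogonal to `v`. -/
theorem IsGaussian.indepFun_inner_sub (hcov : ∀ x y, covarianceBilin μ x y = s * ⟪x, y⟫)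
    {v : E} (hv : v ≠ 0) :
    IndepFun (fun x => ⟪v, x⟫) (fun x => x - (⟪v, x⟫ / ‖v‖ ^ 2) • v) μ := by
  have hv' : ‖v‖ ≠ 0 := norm_ne_zero_iff.2 hv
  refine HasGaussianLaw.indepFun_of_covariance_inner ?_ fun a u => ?_
  · let L : E →L[ℝ] ℝ × E := (innerSL ℝ v).prod
      (ContinuousLinearMap.id ℝ E - ((‖v‖ ^ 2)⁻¹ • innerSL ℝ v).smulRight v)
    have h := (IsGaussian.hasGaussianLaw_id (μ := μ)).map_fun L
    refine h.congr (ae_of_all _ fun x => ?_)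
    simp [L, div_eq_inv_mul]
  · have e1 : (fun x : E => ⟪a, ⟪v, x⟫⟫) = fun x => ⟪a • v, x⟫ := by
      ext x; simp [inner_smul_left, mul_comm]
    have e2 : (fun x : E => ⟪u, x - (⟪v, x⟫ / ‖v‖ ^ 2) • v⟫)
        = fun x => ⟪u - (⟪u, v⟫ / ‖v‖ ^ 2) • v, x⟫ := by
      ext x
      simp only [inner_sub_right, inner_sub_left, inner_smul_right, inner_smul_left]
      simp
      ring
    rw [e1, e2, covariance_inner_inner hcov]
    simp only [inner_sub_right, inner_smul_left, inner_smul_right, real_inner_self_eq_norm_sq]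
    rw [real_inner_comm u v]
    field_simp
    simp

/-- Gaussian integration by parts (Stein's identity) for an isotropic Gaussian measure. -/
theorem IsGaussian.integral_inner_mul (hmean : ∫ x, x ∂μ = 0) (hs : 0 < s)
    (hcov : ∀ x y, covarianceBilin μ x y = s * ⟪x, y⟫) {v : E} (hv : v ≠ 0)
    {f f' : E → ℝ} {C C' : ℝ} (hf : Measurable f) (hf' : Measurable f')
    (hd : ∀ x, HasDerivAt (fun t : ℝ => f (x + t • v)) (f' x) 0)
    (hC : ∀ x, |f x| ≤ C) (hC' : ∀ x, |f' x| ≤ C') :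
    ∫ x, ⟪v, x⟫ * f x ∂μ = s * ∫ x, f' x ∂μ := by
  have hv' : 0 < ‖v‖ := norm_pos_iff.2 hv
  set ξ : E → ℝ := fun x => ⟪v, x⟫ with hξ
  set R : E → E := fun x => x - (⟪v, x⟫ / ‖v‖ ^ 2) • v with hR
  have hξm : Measurable ξ := by fun_prop
  have hRm : Measurable R := by fun_prop
  -- `J` rebuilds `x` from its coordinate along `v` and its independent residual; Fubini then
  -- reduces the claim to the one-dimensional identity for each fixed residual.
  let J : ℝ × E → E := fun z => (z.1 / ‖v‖ ^ 2) • v + z.2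
  have hJm : Measurable J := by fun_prop
  have hJ (x : E) : J (ξ x, R x) = x := by simp [J, ξ, R]
  set w : ℝ≥0 := (s * ‖v‖ ^ 2).toNNReal with hwdef
  have hw : w ≠ 0 := by
    rw [hwdef, Ne, Real.toNNReal_eq_zero, not_le]; positivity
  have hwc : (w : ℝ) = s * ‖v‖ ^ 2 := Real.coe_toNNReal _ (by positivity)
  have hmap : μ.map (fun x => (ξ x, R x)) = (gaussianReal 0 w).prod (μ.map R) := by
    rw [(indepFun_iff_map_prod_eq_prod_map_map hξm.aemeasurable hRm.aemeasurable).1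
      (indepFun_inner_sub hcov hv), map_inner_eq_gaussianReal hmean hcov]
  have : IsProbabilityMeasure (μ.map R) := Measure.isProbabilityMeasure_map hRm.aemeasurable
  have hpm : Measurable (fun x => (ξ x, R x)) := hξm.prodMk hRm
  have hi1 : Integrable (fun x => ⟪v, x⟫ * f x) μ := by
    have : Integrable (fun x : E => ⟪v, x⟫) μ := IsGaussian.integrable_fun_id.const_inner v
    exact this.mul_bdd (c := C) hf.aestronglyMeasurable (ae_of_all _ hC)
  have hi2 : Integrable f' μ := Integrable.of_bound hf'.aestronglyMeasurable C' (ae_of_all _ hC')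
  have hk1 : Measurable fun z : ℝ × E => z.1 * f (J z) := measurable_fst.mul (hf.comp hJm)
  have hk2 : Measurable fun z : ℝ × E => f' (J z) := hf'.comp hJm
  have e1 : ∫ x, ⟪v, x⟫ * f x ∂μ = ∫ z, z.1 * f (J z) ∂(gaussianReal 0 w).prod (μ.map R) := by
    rw [← hmap, integral_map hpm.aemeasurable hk1.aestronglyMeasurable]
    simp only [hJ]; rfl
  have e2 : ∫ x, f' x ∂μ = ∫ z, f' (J z) ∂(gaussianReal 0 w).prod (μ.map R) := by
    rw [← hmap, integral_map hpm.aemeasurable hk2.aestronglyMeasurable]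
    simp only [hJ]
  have j1 : Integrable (fun z : ℝ × E => z.1 * f (J z)) ((gaussianReal 0 w).prod (μ.map R)) := by
    rw [← hmap, integrable_map_measure hk1.aestronglyMeasurable hpm.aemeasurable]
    refine hi1.congr (ae_of_all _ fun x => ?_)
    simp only [Function.comp_apply, hJ]; rfl
  have j2 : Integrable (fun z : ℝ × E => f' (J z)) ((gaussianReal 0 w).prod (μ.map R)) := by
    rw [← hmap, integrable_map_measure hk2.aestronglyMeasurable hpm.aemeasurable]
    refine hi2.congr (ae_of_all _ fun x => ?_)
    simp only [Function.comp_apply, hJ]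
  rw [e1, e2, integral_prod_symm _ j1, integral_prod_symm _ j2, ← integral_const_mul]
  congr 1 with r
  -- The factor `1 / ‖v‖ ^ 2` from this parametrization cancels against the variance `s * ‖v‖ ^ 2`
  -- of the coordinate.
  have hder (t : ℝ) : HasDerivAt (fun t => f (J (t, r))) (f' (J (t, r)) / ‖v‖ ^ 2) t := by
    have h0 : HasDerivAt (fun τ : ℝ => (τ - t) / ‖v‖ ^ 2) (1 / ‖v‖ ^ 2) t :=
      ((hasDerivAt_id t).sub_const t).div_const _
    have h1 : HasDerivAt (fun τ : ℝ => f (J (t, r) + τ • v)) (f' (J (t, r)))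
        ((t - t) / ‖v‖ ^ 2) := by
      simpa using hd (J (t, r))
    have h2 := HasDerivAt.comp t h1 h0
    rw [mul_one_div] at h2
    refine h2.congr_of_eventuallyEq (Filter.Eventually.of_forall fun τ => ?_)
    simp only [Function.comp_apply, J]
    congr 1
    rw [sub_div, sub_smul]
    abel
  rw [integral_id_mul_gaussianReal hw hder (fun t => hC _) (C' := C' / ‖v‖ ^ 2)]
  · rw [hwc, integral_div]
    field_simp
  · intro t
    rw [abs_div, abs_of_pos (by positivity : 0 < ‖v‖ ^ 2)]
    gcongr
    exact hC' _

end Stein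

/-! ### Softmax weights and their entropy -/

section Softmax

variable {ι : Type*} [Fintype ι]

/-- The softmax weights `exp (x i) / ∑ j, exp (x j)`. -/
noncomputable def softmax (x : ι → ℝ) (i : ι) : ℝ := Real.exp (x i) / ∑ j, Real.exp (x j)

variable [Nonempty ι]

theorem sum_exp_pos (x : ι → ℝ) : 0 < ∑ j, Real.exp (x j) :=
  Finset.sum_pos (fun _ _ => Real.exp_pos _) Finset.univ_nonempty

theorem softmax_pos (x : ι → ℝ) (i : ι) : 0 < softmax x i :=
  div_pos (Real.exp_pos _) (sum_exp_pos x)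

theorem sum_softmax (x : ι → ℝ) : ∑ i, softmax x i = 1 := by
  simp only [softmax, ← Finset.sum_div]
  exact div_self (sum_exp_pos x).ne'

theorem softmax_le_one (x : ι → ℝ) (i : ι) : softmax x i ≤ 1 := by
  rw [← sum_softmax x]
  exact Finset.single_le_sum (fun j _ => (softmax_pos x j).le) (Finset.mem_univ i)

theorem log_softmax (x : ι → ℝ) (i : ι) :
    Real.log (softmax x i) = x i - Real.log (∑ j, Real.exp (x j)) := by
  rw [softmax, Real.log_div (Real.exp_pos _).ne' (sum_exp_pos x).ne', Real.log_exp]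

/-- Jensen's inequality for `exp`, via its tangent line at `0` after centring `x` at its mean. -/
theorem log_card_add_mean_le_log_sum_exp (x : ι → ℝ) :
    Real.log (Fintype.card ι) + (∑ i, x i) / Fintype.card ι ≤ Real.log (∑ i, Real.exp (x i)) := by
  have hm : (0 : ℝ) < Fintype.card ι := by exact_mod_cast Fintype.card_pos
  set a : ℝ := (∑ i, x i) / Fintype.card ι with ha
  rw [Real.le_log_iff_exp_le (sum_exp_pos x), Real.exp_add, Real.exp_log hm]
  have h1 : (Fintype.card ι : ℝ) ≤ ∑ i, Real.exp (x i - a) := by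
    calc (Fintype.card ι : ℝ) = ∑ i, (x i - a + 1) := by
          rw [Finset.sum_add_distrib, Finset.sum_sub_distrib]
          simp [ha]
          field_simp
          simp
      _ ≤ _ := Finset.sum_le_sum fun i _ => Real.add_one_le_exp _
  calc (Fintype.card ι : ℝ) * Real.exp a ≤ (∑ i, Real.exp (x i - a)) * Real.exp a := by gcongr
    _ = ∑ i, Real.exp (x i) := by
      rw [Finset.sum_mul]
      simp [← Real.exp_add]

/-- The softmax average dominates the mean, up to an entropy term. -/
theorem le_sum_softmax_mul (x : ι → ℝ) :
    Real.log (Fintype.card ι) * ∑ i, softmax x i ^ 2 - Real.log 2 + (∑ i, x i) / Fintype.card ι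
      ≤ ∑ i, softmax x i * x i := by
  have hm : (0 : ℝ) < Fintype.card ι := by exact_mod_cast Fintype.card_pos
  set m := (Fintype.card ι : ℝ) with hmdef
  set l := Real.log m with hl
  set Z := Real.log (∑ j, Real.exp (x j)) with hZ
  -- Gibbs' inequality will compare the weights `w` with `q i = exp (w i * l) / (2 * m)`. Convexity
  -- of `exp` on `[0, l]` shows that `q` has total mass at most `1`.
  have hq (i : ι) : Real.exp (softmax x i * l) ≤ 1 - softmax x i + softmax x i * m := by
    have h := convexOn_exp.2 (Set.mem_univ (0 : ℝ)) (Set.mem_univ l)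
      (sub_nonneg.2 (softmax_le_one x i)) (softmax_pos x i).le (by ring)
    simpa [hl, Real.exp_log hm] using h
  have hsum : ∑ i, Real.exp (softmax x i * l) ≤ 2 * m := by
    calc _ ≤ ∑ i, (1 - softmax x i + softmax x i * m) := Finset.sum_le_sum fun i _ => hq i
      _ = m - 1 + m := by
        rw [Finset.sum_add_distrib, Finset.sum_sub_distrib, ← Finset.sum_mul, sum_softmax]
        simp [hmdef]
      _ ≤ _ := by linarith
  -- This is `w * log (q / w) ≤ q - w`, with `log w = x i - Z`.
  have hterm (i : ι) : softmax x i * (softmax x i * l - (x i - Z) - (Real.log 2 + l))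
      ≤ Real.exp (softmax x i * l) / (2 * m) - softmax x i := by
    have hp := softmax_pos x i
    have h := Real.log_le_sub_one_of_pos
      (show 0 < Real.exp (softmax x i * l) / (softmax x i * (2 * m)) by positivity)
    rw [Real.log_div (by positivity) (by positivity), Real.log_exp,
      Real.log_mul (by positivity) (by positivity), Real.log_mul (by positivity) (by positivity),
      log_softmax] at h
    calc _ ≤ softmax x i * (Real.exp (softmax x i * l) / (softmax x i * (2 * m)) - 1) := by
          refine mul_le_mul_of_nonneg_left ?_ hp.le
          linarith
      _ = _ := by field_simp
  have hall := Finset.sum_le_sum fun i (_ : i ∈ Finset.univ) => hterm i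
  rw [Finset.sum_sub_distrib, ← Finset.sum_div, sum_softmax] at hall
  have hr : (∑ i, Real.exp (softmax x i * l)) / (2 * m) - 1 ≤ 0 := by
    rw [sub_nonpos, div_le_one (by positivity)]
    exact hsum
  have hleft : ∑ i, softmax x i * (softmax x i * l - (x i - Z) - (Real.log 2 + l))
      = l * ∑ i, softmax x i ^ 2 - ∑ i, softmax x i * x i + (Z - Real.log 2 - l) := by
    have : ∀ i, softmax x i * (softmax x i * l - (x i - Z) - (Real.log 2 + l))
        = l * softmax x i ^ 2 - softmax x i * x i + softmax x i * (Z - Real.log 2 - l) := by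
      intro i; ring
    simp only [this]
    rw [Finset.sum_add_distrib, Finset.sum_sub_distrib, ← Finset.mul_sum, ← Finset.sum_mul,
      sum_softmax, one_mul]
  have := log_card_add_mean_le_log_sum_exp x
  linarith

theorem hasDerivAt_softmax {x : ℝ → ι → ℝ} {x' : ι → ℝ} {t : ℝ}
    (h : ∀ i, HasDerivAt (fun τ => x τ i) (x' i) t) (i : ι) :
    HasDerivAt (fun τ => softmax (x τ) i)
      (softmax (x t) i * (x' i - ∑ j, softmax (x t) j * x' j)) t := by
  have h1 := (h i).exp
  have h2 : HasDerivAt (fun τ => ∑ j, Real.exp (x τ j)) (∑ j, Real.exp (x t j) * x' j) t :=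
    HasDerivAt.fun_sum fun j _ => (h j).exp
  have hZ := (sum_exp_pos (x t)).ne'
  refine (h1.fun_div h2 hZ).congr_deriv ?_
  have : ∑ j, softmax (x t) j * x' j
      = (∑ j, Real.exp (x t j) * x' j) / ∑ j, Real.exp (x t j) := by
    rw [Finset.sum_div]
    exact Finset.sum_congr rfl fun j _ => by rw [softmax]; ring
  rw [this, softmax]
  field_simp

theorem sum_mul_le_sup' {w x : ι → ℝ} (hw : ∀ i, 0 ≤ w i) (h1 : ∑ i, w i = 1) :
    ∑ i, w i * x i ≤ Finset.univ.sup' Finset.univ_nonempty x := by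
  calc ∑ i, w i * x i ≤ ∑ i, w i * Finset.univ.sup' Finset.univ_nonempty x :=
        Finset.sum_le_sum fun i hi => mul_le_mul_of_nonneg_left (Finset.le_sup' x hi) (hw i)
    _ = _ := by rw [← Finset.sum_mul, h1, one_mul]

end Softmax

/-! ### Variance of separated points -/

section Separation

variable {ι : Type*} [Fintype ι] {E : Type*} [NormedAddCommGroup E] [InnerProductSpace ℝ E]

/-- The variance of separated points under a probability vector. -/
theorem mul_one_sub_sum_sq_le {a : ι → E} {κ : ℝ} (hsep : ∀ i j, i ≠ j → 2 * κ ≤ ‖a i - a j‖ ^ 2)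
    {w : ι → ℝ} (hw : ∀ i, 0 ≤ w i) (h1 : ∑ i, w i = 1) :
    κ * (1 - ∑ i, w i ^ 2) ≤ ∑ i, w i * (⟪a i, a i⟫ - ∑ j, w j * ⟪a j, a i⟫) := by
  classical
  have hL : κ * (1 - ∑ i, w i ^ 2)
      = ∑ i, ∑ j, (κ * (w i * w j) - if i = j then κ * (w i * w j) else 0) := by
    simp only [Finset.sum_sub_distrib, Finset.sum_ite_eq, Finset.mem_univ, if_true,
      ← Finset.mul_sum, h1, mul_one]
    rw [mul_sub, mul_one]
    simp only [sq]
  -- The variance is half the mean squared distance between two independent draws; only the diagonal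
  -- pairs escape the separation.
  have hR : ∑ i, w i * (⟪a i, a i⟫ - ∑ j, w j * ⟪a j, a i⟫)
      = ∑ i, ∑ j, w i * w j * (‖a i - a j‖ ^ 2 / 2) := by
    have e : ∀ i j, w i * w j * (‖a i - a j‖ ^ 2 / 2)
        = w i * ⟪a i, a i⟫ / 2 * w j + w i / 2 * (w j * ⟪a j, a j⟫)
          - w i * (w j * ⟪a j, a i⟫) := by
      intro i j
      rw [← real_inner_self_eq_norm_sq, inner_sub_left, inner_sub_right, inner_sub_right,
        real_inner_comm (a j) (a i)]
      ring
    simp only [e, Finset.sum_sub_distrib, Finset.sum_add_distrib, ← Finset.mul_sum,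
      ← Finset.sum_mul, h1, mul_sub, ← Finset.sum_div]
    ring
  rw [hL, hR]
  refine Finset.sum_le_sum fun i _ => Finset.sum_le_sum fun j _ => ?_
  have hij : 0 ≤ w i * w j := mul_nonneg (hw i) (hw j)
  split_ifs with h
  · rw [sub_self]; positivity
  · nlinarith [hsep i j h]

end Separation

/-! ### Sudakov minoration -/

section Sudakov

variable {ι : Type*} [Fintype ι] [Nonempty ι]
  {E : Type*} [NormedAddCommGroup E] [InnerProductSpace ℝ E] [FiniteDimensional ℝ E]
  [MeasurableSpace E] [BorelSpace E] {μ : Measure E} [IsGaussian μ] {s : ℝ}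

theorem IsGaussian.integrable_inner (v : E) : Integrable (fun x => ⟪v, x⟫) μ :=
  IsGaussian.integrable_fun_id.const_inner v

theorem IsGaussian.integrable_sup'_inner (a : ι → E) :
    Integrable (fun x => Finset.univ.sup' Finset.univ_nonempty fun i => ⟪a i, x⟫) μ := by
  have hm : Measurable fun x : E => Finset.univ.sup' Finset.univ_nonempty fun i => ⟪a i, x⟫ := by
    have := Finset.measurable_sup' Finset.univ_nonempty (f := fun i (x : E) => ⟪a i, x⟫)
      fun i _ => by fun_prop
    convert this with x
    simp [Finset.sup'_apply]
  refine Integrable.mono' (integrable_finsetSum Finset.univ fun i _ =>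
    (integrable_inner (μ := μ) (a i)).abs) hm.aestronglyMeasurable (ae_of_all _ fun x => ?_)
  obtain ⟨i, hi, h⟩ := Finset.exists_mem_eq_sup' Finset.univ_nonempty fun i => ⟪a i, x⟫
  rw [h, Real.norm_eq_abs]
  exact Finset.single_le_sum (f := fun i => |⟪a i, x⟫|) (fun j _ => abs_nonneg _) hi

theorem measurable_softmax_inner {ι : Type*} [Fintype ι]
    (a : ι → E) (b : ℝ) (i : ι) :
    Measurable fun x : E => softmax (fun j => b * ⟪a j, x⟫) i := by
  unfold softmax
  fun_prop

/-- Sudakov minoration for an isotropic Gaussian measure. -/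
theorem IsGaussian.le_integral_sup'_inner (hmean : ∫ x, x ∂μ = 0) (hs : 0 < s)
    (hcov : ∀ x y, covarianceBilin μ x y = s * ⟪x, y⟫) {a : ι → E} (ha : ∀ i, a i ≠ 0)
    {κ : ℝ} (hκ : 0 < κ) (hsep : ∀ i j, i ≠ j → 2 * κ ^ 2 ≤ ‖a i - a j‖ ^ 2)
    (hcard : 2 ≤ Fintype.card ι) :
    √s * κ * ((Real.log (Fintype.card ι) - Real.log 2) / (2 * √(Real.log (Fintype.card ι))))
      ≤ ∫ x, Finset.univ.sup' Finset.univ_nonempty (fun i => ⟪a i, x⟫) ∂μ := by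
  set l := Real.log (Fintype.card ι) with hl
  have hl0 : 0 < l := Real.log_pos (by exact_mod_cast hcard)
  have hss : 0 < √s := Real.sqrt_pos.2 hs
  have hsl : 0 < √l := Real.sqrt_pos.2 hl0
  -- The inverse temperature is fixed by `b * (s * b * κ ^ 2) = l`, so that `S` cancels between
  -- `hA1` and `hA2`.
  set b : ℝ := √l / (√s * κ) with hb
  have hb0 : 0 < b := by positivity
  let w : E → ι → ℝ := fun x => softmax fun j => b * ⟪a j, x⟫
  have hw0 (x : E) (i : ι) : 0 < w x i := softmax_pos _ i
  have hw1 (x : E) : ∑ i, w x i = 1 := sum_softmax _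
  have hwle (x : E) (i : ι) : w x i ≤ 1 := softmax_le_one _ i
  have hwabs (x : E) (i : ι) : |w x i| ≤ 1 := by
    rw [abs_of_pos (hw0 x i)]; exact hwle x i
  have hwm (i : ι) : Measurable fun x => w x i := measurable_softmax_inner a b i
  have hstein (i : ι) : ∫ x, ⟪a i, x⟫ * w x i ∂μ
      = s * ∫ x, w x i * (b * ⟪a i, a i⟫ - ∑ j, w x j * (b * ⟪a j, a i⟫)) ∂μ := by
    refine integral_inner_mul hmean hs hcov (ha i) (C := 1)
      (C' := |b * ⟪a i, a i⟫| + ∑ j, |b * ⟪a j, a i⟫|) (hwm i) ?_ ?_ (fun x => hwabs x i) ?_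
    · fun_prop
    · intro x
      have h := hasDerivAt_softmax (x := fun (t : ℝ) j => b * ⟪a j, x + t • a i⟫)
        (x' := fun j => b * ⟪a j, a i⟫) (t := 0) (fun j => ?_) i
      · simpa [w] using h
      · simp only [inner_add_right, inner_smul_right]
        have := (((hasDerivAt_id (0 : ℝ)).mul_const ⟪a j, a i⟫).const_add ⟪a j, x⟫).const_mul b
        simpa using this
    · intro x
      rw [abs_mul]
      calc |w x i| * |b * ⟪a i, a i⟫ - ∑ j, w x j * (b * ⟪a j, a i⟫)|
          ≤ 1 * |b * ⟪a i, a i⟫ - ∑ j, w x j * (b * ⟪a j, a i⟫)| := by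
            gcongr; exact hwabs x i
        _ ≤ |b * ⟪a i, a i⟫| + |∑ j, w x j * (b * ⟪a j, a i⟫)| := by
            rw [one_mul]; exact abs_sub _ _
        _ ≤ _ := by
            gcongr
            refine (Finset.abs_sum_le_sum_abs _ _).trans (Finset.sum_le_sum fun j _ => ?_)
            rw [abs_mul]
            exact mul_le_of_le_one_left (abs_nonneg _) (hwabs x j)
  have hint (i : ι) : Integrable (fun x => ⟪a i, x⟫ * w x i) μ :=
    (integrable_inner (a i)).mul_bdd (c := 1) (hwm i).aestronglyMeasurable
      (ae_of_all _ fun x => hwabs x i)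
  have hbdd {f : E → ℝ} (hf : Measurable f) {C : ℝ} (hC : ∀ x, |f x| ≤ C) : Integrable f μ :=
    Integrable.of_bound hf.aestronglyMeasurable C (ae_of_all _ hC)
  have hsq (i : ι) : Integrable (fun x => w x i ^ 2) μ :=
    hbdd ((hwm i).pow_const 2) (C := 1) fun x => by
      rw [abs_pow]; exact pow_le_one₀ (abs_nonneg _) (hwabs x i)
  have hS : Integrable (fun x => ∑ i, w x i ^ 2) μ := integrable_finsetSum _ fun i _ => hsq i
  have hG : Integrable (fun x => ∑ i, ⟪a i, x⟫ * w x i) μ := integrable_finsetSum _ fun i _ => hint i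
  set S := ∫ x, ∑ i, w x i ^ 2 ∂μ with hSdef
  set A := ∫ x, ∑ i, ⟪a i, x⟫ * w x i ∂μ with hAdef
  have hI (i : ι) : Integrable
      (fun x => w x i * (b * ⟪a i, a i⟫ - ∑ j, w x j * (b * ⟪a j, a i⟫))) μ := by
    have h1 : Integrable (fun x => b * ⟪a i, a i⟫ - ∑ j, w x j * (b * ⟪a j, a i⟫)) μ :=
      (integrable_const _).sub (integrable_finsetSum _ fun j _ =>
        (hbdd (hwm j) (fun x => hwabs x j)).mul_const _)
    exact h1.bdd_mul (c := 1) (hwm i).aestronglyMeasurable (ae_of_all _ fun x => hwabs x i)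
  -- Variance bound: Stein's identity for each weight, then the separation of the points.
  have hA1 : s * b * κ ^ 2 * (1 - S) ≤ A := by
    have e : A = ∫ x, s * b * ∑ i, w x i * (⟪a i, a i⟫ - ∑ j, w x j * ⟪a j, a i⟫) ∂μ := by
      rw [hAdef, integral_finsetSum _ fun i _ => hint i]
      simp only [hstein]
      rw [← Finset.mul_sum, ← integral_finsetSum _ fun i _ => hI i, ← integral_const_mul]
      congr 1 with x
      rw [mul_assoc, Finset.mul_sum (a := b)]
      congr 2 with i
      rw [show ∑ j, w x j * (b * ⟪a j, a i⟫) = b * ∑ j, w x j * ⟪a j, a i⟫ by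
        rw [Finset.mul_sum]; exact Finset.sum_congr rfl fun j _ => by ring]
      ring
    have e2 : s * b * κ ^ 2 * (1 - S) = ∫ x, s * b * (κ ^ 2 * (1 - ∑ i, w x i ^ 2)) ∂μ := by
      rw [integral_const_mul, integral_const_mul, integral_sub (integrable_const _) hS]
      simp [hSdef, mul_assoc]
    rw [e, e2]
    refine integral_mono (((((integrable_const _).sub hS)).const_mul _).const_mul _) ?_ fun x => ?_
    · refine (integrable_finsetSum _ fun i _ => ?_).const_mul _
      have h1 : Integrable (fun x => ⟪a i, a i⟫ - ∑ j, w x j * ⟪a j, a i⟫) μ :=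
        (integrable_const _).sub (integrable_finsetSum _ fun j _ =>
          (hbdd (hwm j) (fun x => hwabs x j)).mul_const _)
      exact h1.bdd_mul (c := 1) (hwm i).aestronglyMeasurable (ae_of_all _ fun x => hwabs x i)
    · exact mul_le_mul_of_nonneg_left
        (mul_one_sub_sum_sq_le hsep (fun i => (hw0 x i).le) (hw1 x)) (by positivity)
  -- Entropy bound: the mean term has zero expectation since the measure is centred.
  have hA2 : l * S - Real.log 2 ≤ b * A := by
    have hmeani : Integrable (fun x => (∑ i, b * ⟪a i, x⟫) / (Fintype.card ι : ℝ)) μ :=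
      (integrable_finsetSum _ fun i _ => (integrable_inner (a i)).const_mul b).div_const _
    have e0 : ∫ x, (∑ i, b * ⟪a i, x⟫) / (Fintype.card ι : ℝ) ∂μ = 0 := by
      rw [integral_div, integral_finsetSum _ fun i _ => (integrable_inner (a i)).const_mul b]
      simp [integral_const_mul, integral_inner_eq_zero hmean]
    have e1 : l * S - Real.log 2 = ∫ x, (l * ∑ i, w x i ^ 2 - Real.log 2
        + (∑ i, b * ⟪a i, x⟫) / (Fintype.card ι : ℝ)) ∂μ := by
      rw [integral_add (f := fun x => l * ∑ i, w x i ^ 2 - Real.log 2)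
        ((hS.const_mul l).sub (integrable_const _)) hmeani, e0, add_zero,
        integral_sub (hS.const_mul l) (integrable_const _), integral_const_mul]
      simp [hSdef]
    rw [e1, hAdef, ← integral_const_mul]
    refine integral_mono (((hS.const_mul l).sub (integrable_const _)).add hmeani)
      (hG.const_mul b) fun x => ?_
    refine (le_sum_softmax_mul fun j => b * ⟪a j, x⟫).trans (le_of_eq ?_)
    simp only [w, Finset.mul_sum]
    exact Finset.sum_congr rfl fun i _ => by ring
  have hA3 : A ≤ ∫ x, Finset.univ.sup' Finset.univ_nonempty (fun i => ⟪a i, x⟫) ∂μ := by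
    refine integral_mono hG (integrable_sup'_inner a) fun x => ?_
    simp only [mul_comm ⟪_, x⟫]
    exact sum_mul_le_sup' (x := fun i => ⟪a i, x⟫) (fun i => (hw0 x i).le) (hw1 x)
  refine le_trans ?_ hA3
  have hbk : b * (s * b * κ ^ 2) = l := by
    have h1 : √s ^ 2 = s := Real.sq_sqrt hs.le
    have h2 : √l ^ 2 = l := Real.sq_sqrt hl0.le
    rw [hb]
    field_simp
    rw [h1, h2, mul_comm]
  have h2A : l - Real.log 2 ≤ 2 * (b * A) := by
    have := mul_le_mul_of_nonneg_left hA1 hb0.le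
    rw [← mul_assoc, hbk] at this
    linarith
  have : √s * κ * ((l - Real.log 2) / (2 * √l)) = (l - Real.log 2) / 2 / b := by
    rw [hb]; field_simp
  rw [this, div_le_iff₀ hb0]
  linarith

end Sudakov

/-! ### Convex penalized least squares -/

section PenalizedLeastSquares

variable {n p : ℕ} {X : Matrix (Fin n) (Fin p) ℝ} {h : EuclideanSpace ℝ (Fin p) → ℝ}
  {y : EuclideanSpace ℝ (Fin n)} {b : EuclideanSpace ℝ (Fin p)}

/-- First order optimality condition for convex penalized least squares. -/
theorem IsPenalizedLeastSquares.inner_le (hb : IsPenalizedLeastSquares X h y b)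
    (hh : ConvexOn ℝ Set.univ h) (β : EuclideanSpace ℝ (Fin p)) :
    ⟪y - X.toEuclideanLin b, X.toEuclideanLin (β - b)⟫ ≤ h β - h b := by
  set v := X.toEuclideanLin (β - b) with hv
  set c := h β - h b - ⟪y - X.toEuclideanLin b, v⟫ with hc
  -- Compare `b` with a point of the segment towards `β`, and divide by `t`.
  have key (t : ℝ) (ht0 : 0 < t) (ht1 : t ≤ 1) : 0 ≤ 2 * c + t * ‖v‖ ^ 2 := by
    have h1 := hb (b + t • (β - b))
    have h2 : h (b + t • (β - b)) ≤ (1 - t) * h b + t * h β := by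
      have h3 := hh.2 (Set.mem_univ b) (Set.mem_univ β) (sub_nonneg.2 ht1) ht0.le (by ring)
      rw [show b + t • (β - b) = (1 - t) • b + t • β by
        rw [smul_sub, sub_smul, one_smul]; abel]
      exact h3
    have h4 : ‖X.toEuclideanLin (b + t • (β - b)) - y‖ ^ 2
        = ‖X.toEuclideanLin b - y‖ ^ 2 - 2 * t * ⟪y - X.toEuclideanLin b, v⟫
          + t ^ 2 * ‖v‖ ^ 2 := by
      rw [map_add, map_smul, ← hv, add_sub_right_comm, norm_add_sq_real, inner_smul_right,
        norm_smul, mul_pow, Real.norm_eq_abs, sq_abs, ← neg_sub y, inner_neg_left]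
      ring
    rw [h4] at h1
    have h5 : 0 ≤ t * (2 * c + t * ‖v‖ ^ 2) := by rw [hc]; linarith
    exact nonneg_of_mul_nonneg_right h5 ht0
  have : 0 ≤ c := by
    by_contra! hneg
    have hD : 0 < ‖v‖ ^ 2 + 1 := by positivity
    -- If `c < 0`, this `t` gives `2 * c + t * ‖v‖ ^ 2 ≤ c < 0`; the `+ 1` keeps the denominator
    -- positive when `v = 0`.
    have ht : 0 < min 1 (-c / (‖v‖ ^ 2 + 1)) := lt_min one_pos (div_pos (by linarith) hD)
    have h1 := key _ ht (min_le_left _ _)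
    have h2 : min 1 (-c / (‖v‖ ^ 2 + 1)) * ‖v‖ ^ 2 ≤ -c :=
      calc _ ≤ -c / (‖v‖ ^ 2 + 1) * (‖v‖ ^ 2 + 1) :=
            mul_le_mul (min_le_right _ _) (by linarith) (by positivity)
              (ht.le.trans (min_le_right _ _))
        _ = -c := div_mul_cancel₀ _ hD.ne'
    linarith
  linarith

/-- The fitted value of a convex penalized least squares problem is a nonexpansive function of the
response. -/
theorem IsPenalizedLeastSquares.norm_sub_le (hh : ConvexOn ℝ Set.univ h)
    (hb : IsPenalizedLeastSquares X h y b) {y' : EuclideanSpace ℝ (Fin n)}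
    {b' : EuclideanSpace ℝ (Fin p)} (hb' : IsPenalizedLeastSquares X h y' b') :
    ‖X.toEuclideanLin b - X.toEuclideanLin b'‖ ≤ ‖y - y'‖ := by
  have h1 := hb.inner_le hh b'
  have h2 := hb'.inner_le hh b
  rw [map_sub] at h1 h2
  set u := X.toEuclideanLin b - X.toEuclideanLin b' with hu
  rw [← neg_sub (X.toEuclideanLin b) (X.toEuclideanLin b'), ← hu, inner_neg_right] at h1
  -- Adding the two optimality conditions cancels the penalties.
  have h3 : ⟪u, u⟫ ≤ ⟪y - y', u⟫ := by
    have e : (y' - X.toEuclideanLin b') - (y - X.toEuclideanLin b) = u - (y - y') := by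
      rw [hu]; abel
    have : ⟪u - (y - y'), u⟫ ≤ 0 := by
      rw [← e, inner_sub_left]; linarith
    rw [inner_sub_left] at this
    linarith
  have h4 := real_inner_le_norm (y - y') u
  rw [real_inner_self_eq_norm_sq] at h3
  rcases (norm_nonneg u).eq_or_lt with h0 | h0
  · rw [← h0]; positivity
  · nlinarith

/-- The prediction error of convex penalized least squares is integrable if the noise is. -/
theorem integrable_norm_prediction_error {Ω : Type*} [MeasurableSpace Ω] {P : Measure Ω}
    [IsProbabilityMeasure P] (hh : ConvexOn ℝ Set.univ h) (βstar : EuclideanSpace ℝ (Fin p))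
    {ε : Ω → EuclideanSpace ℝ (Fin n)} (hε : Integrable ε P)
    {βhat : Ω → EuclideanSpace ℝ (Fin p)}
    (hβ : ∀ᵐ ω ∂P, IsPenalizedLeastSquares X h (X.toEuclideanLin βstar + ε ω) (βhat ω)) :
    Integrable (fun ω => ‖X.toEuclideanLin (βhat ω - βstar)‖) P := by
  -- `βhat` need not be measurable, but its fitted value is determined by the noise. The error is
  -- thus a 1-Lipschitz function on the set `S` of noises admitting a minimizer; its extension `G`
  -- to the whole space gives measurability and linear growth.
  let S : Set (EuclideanSpace ℝ (Fin n)) :=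
    {z | ∃ b, IsPenalizedLeastSquares X h (X.toEuclideanLin βstar + z) b}
  classical
  let F : EuclideanSpace ℝ (Fin n) → ℝ := fun z =>
    if hz : z ∈ S then ‖X.toEuclideanLin (hz.choose - βstar)‖ else 0
  have hF : ∀ z ∈ S, ∀ b, IsPenalizedLeastSquares X h (X.toEuclideanLin βstar + z) b →
      F z = ‖X.toEuclideanLin (b - βstar)‖ := by
    intro z hz b hb
    simp only [F, dif_pos hz]
    have h1 := hz.choose_spec.norm_sub_le hh hb
    rw [sub_self, norm_zero, norm_le_zero_iff, sub_eq_zero] at h1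
    rw [map_sub, map_sub, h1]
  have hlip : LipschitzOnWith 1 F S := by
    refine LipschitzOnWith.of_dist_le_mul fun z hz z' hz' => ?_
    obtain ⟨b, hb⟩ := hz
    obtain ⟨b', hb'⟩ := hz'
    rw [hF z ⟨b, hb⟩ b hb, hF z' ⟨b', hb'⟩ b' hb', NNReal.coe_one, one_mul, Real.dist_eq,
      dist_eq_norm]
    refine (abs_norm_sub_norm_le _ _).trans ?_
    rw [← map_sub, sub_sub_sub_cancel_right, map_sub]
    simpa using hb.norm_sub_le hh hb'
  obtain ⟨G, hG, hFG⟩ := hlip.extend_real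
  have hae : (fun ω => ‖X.toEuclideanLin (βhat ω - βstar)‖) =ᵐ[P] fun ω => G (ε ω) := by
    filter_upwards [hβ] with ω hω
    rw [← hFG ⟨_, hω⟩, hF _ ⟨_, hω⟩ _ hω]
  refine Integrable.congr ?_ hae.symm
  refine Integrable.mono' ((integrable_const |G 0|).add hε.norm)
    (hG.continuous.comp_aestronglyMeasurable hε.aestronglyMeasurable) (ae_of_all _ fun ω => ?_)
  have h1 := hG.dist_le_mul (ε ω) 0
  rw [NNReal.coe_one, one_mul, Real.dist_eq, dist_zero_right] at h1
  have h2 := abs_sub_abs_le_abs_sub (G (ε ω)) (G 0)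
  rw [Real.norm_eq_abs]
  simp only [Pi.add_apply]
  linarith

/-- The noise barrier: a lower bound on the prediction error in every direction. -/
theorem IsPenalizedLeastSquares.inner_sub_le (hh : ConvexOn ℝ Set.univ h)
    (hsub : ∀ u v, h (u + v) ≤ h u + h v) {βstar : EuclideanSpace ℝ (Fin p)}
    {z : EuclideanSpace ℝ (Fin n)}
    (hb : IsPenalizedLeastSquares X h (X.toEuclideanLin βstar + z) b)
    (u : EuclideanSpace ℝ (Fin p)) :
    ⟪z, X.toEuclideanLin u⟫ - h u
      ≤ ‖X.toEuclideanLin u‖ * ‖X.toEuclideanLin (b - βstar)‖ := by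
  -- Testing at `b + u` leaves `h (b + u) - h b`, which subadditivity bounds by `h u` whatever `b`
  -- is.
  have h1 := hb.inner_le hh (b + u)
  rw [add_sub_cancel_left] at h1
  have e : X.toEuclideanLin βstar + z - X.toEuclideanLin b
      = z - X.toEuclideanLin (b - βstar) := by rw [map_sub]; abel
  rw [e, inner_sub_left] at h1
  have h2 := real_inner_le_norm (X.toEuclideanLin (b - βstar)) (X.toEuclideanLin u)
  have h3 := hsub b u
  linarith

end PenalizedLeastSquares

/-! ### The Lasso penalty and 0-1 vectors -/

section Lasso

variable {n p : ℕ} {lam : ℝ}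

theorem lassoPenalty_add_le (hlam : 0 ≤ lam) (u v : EuclideanSpace ℝ (Fin p)) :
    lassoPenalty n lam (u + v) ≤ lassoPenalty n lam u + lassoPenalty n lam v := by
  rw [lassoPenalty, lassoPenalty, lassoPenalty, ← mul_add, ← Finset.sum_add_distrib]
  gcongr
  exact abs_add_le _ _

theorem lassoPenalty_smul {t : ℝ} (ht : 0 ≤ t) (u : EuclideanSpace ℝ (Fin p)) :
    lassoPenalty n lam (t • u) = t * lassoPenalty n lam u := by
  simp only [lassoPenalty, PiLp.smul_apply, smul_eq_mul, abs_mul, abs_of_nonneg ht,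
    ← Finset.mul_sum]
  ring

theorem convexOn_lassoPenalty (hlam : 0 ≤ lam) :
    ConvexOn ℝ Set.univ (lassoPenalty (p := p) n lam) := by
  refine ⟨convex_univ, fun u _ v _ s t hs ht _ => (lassoPenalty_add_le hlam _ _).trans ?_⟩
  rw [lassoPenalty_smul hs, lassoPenalty_smul ht, smul_eq_mul, smul_eq_mul]

/-- The `0`-`1` vector with support `S`. -/
noncomputable def indicatorVector (S : Finset (Fin p)) : EuclideanSpace ℝ (Fin p) :=
  ∑ j ∈ S, EuclideanSpace.single j 1

theorem indicatorVector_apply (S : Finset (Fin p)) (i : Fin p) :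
    indicatorVector S i = if i ∈ S then 1 else 0 := by
  simp [indicatorVector, Finset.sum_apply, Pi.single_apply]

theorem sparsity_indicatorVector (S : Finset (Fin p)) : sparsity (indicatorVector S) = S.card := by
  simp [sparsity, indicatorVector_apply]

theorem norm_indicatorVector (S : Finset (Fin p)) : ‖indicatorVector S‖ = √(S.card : ℝ) := by
  rw [EuclideanSpace.norm_eq]
  simp [indicatorVector_apply, apply_ite]

theorem lassoPenalty_indicatorVector (S : Finset (Fin p)) :
    lassoPenalty n lam (indicatorVector S) = √(n : ℝ) * lam * S.card := by
  simp [lassoPenalty, indicatorVector_apply, apply_ite]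

end Lasso

/-! ### Restricted isometry bounds -/

section RestrictedIsometry

variable {n p s : ℕ} {X : Matrix (Fin n) (Fin p) ℝ}

theorem norm_toEuclideanLin_le (hn : 1 ≤ n) {β : EuclideanSpace ℝ (Fin p)} (hβ : sparsity β ≤ s) :
    ‖X.toEuclideanLin β‖ ≤ √(n : ℝ) * (1 + ripConstant X s) * ‖β‖ := by
  have hn' : 0 < √(n : ℝ) := Real.sqrt_pos.2 (by exact_mod_cast hn)
  have h := ((isLeast_ripConstant X s).1.2 β hβ).2
  rw [one_div, inv_mul_le_iff₀ hn'] at h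
  linarith

theorem le_norm_toEuclideanLin (hn : 1 ≤ n) {β : EuclideanSpace ℝ (Fin p)} (hβ : sparsity β ≤ s) :
    √(n : ℝ) * (1 - ripConstant X s) * ‖β‖ ≤ ‖X.toEuclideanLin β‖ := by
  have hn' : 0 < √(n : ℝ) := Real.sqrt_pos.2 (by exact_mod_cast hn)
  have h := ((isLeast_ripConstant X s).1.2 β hβ).1
  rw [one_div, le_inv_mul_iff₀ hn'] at h
  linarith

theorem sparsity_single_le (i : Fin p) : sparsity (EuclideanSpace.single i (1 : ℝ)) ≤ 1 := by
  refine Finset.card_le_one.2 fun j hj k hk => ?_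
  simp_all

theorem sparsity_sub_le (u v : EuclideanSpace ℝ (Fin p)) :
    sparsity (u - v) ≤ sparsity u + sparsity v := by
  classical
  refine (Finset.card_le_card ?_).trans (Finset.card_union_le _ _)
  intro j hj
  rw [Finset.mem_filter, PiLp.sub_apply] at hj
  rw [Finset.mem_union, Finset.mem_filter, Finset.mem_filter]
  by_contra! h
  exact hj.2 (by rw [h.1 (Finset.mem_univ j), h.2 (Finset.mem_univ j), sub_zero])

end RestrictedIsometry

/-! ### Covariance of the noise -/

section Gaussian

variable {n : ℕ}

theorem covarianceBilin_multivariateGaussian_smul_one (σ : ℝ) (x y : EuclideanSpace ℝ (Fin n)) :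
    covarianceBilin (multivariateGaussian 0 (σ ^ 2 • (1 : Matrix (Fin n) (Fin n) ℝ))) x y
      = σ ^ 2 * ⟪x, y⟫ := by
  rw [covarianceBilin_multivariateGaussian (Matrix.PosSemidef.one.smul (sq_nonneg σ))]
  simp [Matrix.smul_mulVec, dotProduct_smul, EuclideanSpace.inner_eq_star_dotProduct,
    dotProduct_comm]

end Gaussian

/-- Let `m = ⌊p/d⌋` and `l = log m`. From `p ≤ d (m + 1)` follows `p/(5d) ≤ m/2`, so `log (p/(5d)) ≤
l - log 2 ≤ l`; and `m ≥ 4` gives `l ≤ 2 (l - log 2)`. This absorbs both the rounding and the `log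
2` lost in the Sudakov bound. -/
theorem log_div_five_mul_le {p d : ℕ} (hd : 1 ≤ d) (hdp : 5 * d ≤ p) :
    √(Real.log ((p : ℝ) / (5 * (d : ℝ)))) / 4
      ≤ (Real.log ((p / d : ℕ) : ℝ) - Real.log 2) / (2 * √(Real.log ((p / d : ℕ) : ℝ))) := by
  have hm : 5 ≤ p / d := (Nat.le_div_iff_mul_le hd).2 hdp
  have hlt : p < d * (p / d + 1) := Nat.lt_mul_div_succ p hd
  set m := p / d
  have hd' : (0 : ℝ) < d := by exact_mod_cast hd
  have hm' : (5 : ℝ) ≤ m := by exact_mod_cast hm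
  have hx : (p : ℝ) / (5 * d) ≤ m / 2 := by
    rw [div_le_iff₀ (by positivity)]
    have : (p : ℝ) ≤ d * (m + 1) := by exact_mod_cast hlt.le
    nlinarith
  have hx1 : 1 ≤ (p : ℝ) / (5 * d) := by
    rw [le_div_iff₀ (by positivity), one_mul]
    exact_mod_cast hdp
  set l := Real.log (m : ℝ)
  have h1 : Real.log ((p : ℝ) / (5 * d)) ≤ l - Real.log 2 := by
    rw [← Real.log_div (by positivity) (by norm_num)]
    exact Real.log_le_log (by linarith) hx
  have h2 : 2 * Real.log 2 ≤ l := by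
    rw [← Real.log_rpow (by norm_num)]
    exact Real.log_le_log (by positivity) (by norm_num; linarith)
  have hlog2 : 0 < Real.log 2 := Real.log_pos (by norm_num)
  have hl : 0 < l := by linarith
  have hls : 0 < √l := Real.sqrt_pos.2 hl
  rw [le_div_iff₀ (by positivity)]
  have h3 : √(Real.log ((p : ℝ) / (5 * d))) * √l ≤ 2 * (l - Real.log 2) := by
    calc √(Real.log ((p : ℝ) / (5 * d))) * √l ≤ √l * √l := by
          gcongr
          linarith
      _ = l := Real.mul_self_sqrt hl.le
      _ ≤ _ := by linarith
  linarith

/-! ### The lower bound for the Lasso -/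

theorem mainTheorem3 {Ω : Type*} [MeasurableSpace Ω] (P : Measure Ω) [IsProbabilityMeasure P]
    (n p d : ℕ) (hn : 1 ≤ n) (hd : 1 ≤ d) (hdp : 5 * d ≤ p)
    (X : Matrix (Fin n) (Fin p) ℝ) (βstar : EuclideanSpace ℝ (Fin p))
    (σ : ℝ) (hσ : 0 < σ) (lam : ℝ) (hlam : 0 ≤ lam)
    (ε : Ω → EuclideanSpace ℝ (Fin n))
    (hε : HasLaw ε
      (multivariateGaussian 0 (σ ^ 2 • (1 : Matrix (Fin n) (Fin n) ℝ))) P)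
    (βhat : Ω → EuclideanSpace ℝ (Fin p))
    (hβhat : ∀ᵐ ω ∂P, IsPenalizedLeastSquares X (lassoPenalty n lam)
      (X.toEuclideanLin βstar + ε ω) (βhat ω))
    (hsmall : lam ≤ (1 - ripConstant X (2 * d)) / 8 * σ *
      √(Real.log ((p : ℝ) / (5 * (d : ℝ))))) :
    Integrable (fun ω => ‖X.toEuclideanLin (βhat ω - βstar)‖) P ∧
    (1 - ripConstant X (2 * d)) / (8 * (1 + ripConstant X d)) * σ *
        √((d : ℝ) * Real.log ((p : ℝ) / (5 * (d : ℝ))))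
      ≤ ∫ ω, ‖X.toEuclideanLin (βhat ω - βstar)‖ ∂P := by
  have hconv := convexOn_lassoPenalty (p := p) (n := n) hlam
  have hint := integrable_norm_prediction_error hconv βstar hε.hasGaussianLaw.integrable hβhat
  refine ⟨hint, ?_⟩
  have hδ : 0 ≤ ripConstant X d := (isLeast_ripConstant X d).1.1
  set δ := ripConstant X d
  set δ' := ripConstant X (2 * d)
  have hI0 : 0 ≤ ∫ ω, ‖X.toEuclideanLin (βhat ω - βstar)‖ ∂P :=
    integral_nonneg fun ω => norm_nonneg _
  set I := ∫ ω, ‖X.toEuclideanLin (βhat ω - βstar)‖ ∂P with hI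
  -- If `δ' ≥ 1` the claimed lower bound is nonpositive.
  rcases le_or_gt (1 - δ') 0 with hneg | hpos
  · refine le_trans ?_ hI0
    exact mul_nonpos_of_nonpos_of_nonneg (mul_nonpos_of_nonpos_of_nonneg
      (div_nonpos_of_nonpos_of_nonneg hneg (by positivity)) hσ.le) (Real.sqrt_nonneg _)
  set m := p / d
  have hm : 5 ≤ m := (Nat.le_div_iff_mul_le hd).2 hdp
  have : NeZero m := ⟨by omega⟩
  have hdm : d * m ≤ p := Nat.mul_div_le p d
  have hn0 : 0 < √(n : ℝ) := Real.sqrt_pos.2 (by exact_mod_cast hn)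
  have hd0 : (0 : ℝ) < d := by exact_mod_cast hd
  set μ := multivariateGaussian 0 (σ ^ 2 • (1 : Matrix (Fin n) (Fin n) ℝ))
  let a : Fin p → EuclideanSpace ℝ (Fin n) := fun j =>
    X.toEuclideanLin (EuclideanSpace.single j 1)
  -- Column `j` of block `k`; the at most `d - 1` columns beyond `d * m` are discarded.
  let idx : Fin d → Fin m → Fin p := fun k j => Fin.castLE hdm (finProdFinEquiv (k, j))
  have hidx {k k' j j'} (h : idx k j = idx k' j') : k = k' ∧ j = j' := by
    simpa [idx] using h
  have ha (j : Fin p) : √(n : ℝ) * (1 - δ') ≤ ‖a j‖ := by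
    have := le_norm_toEuclideanLin (X := X) (s := 2 * d) hn
      ((sparsity_single_le j).trans (by omega))
    simpa using this
  -- A difference of two basis vectors is 2-sparse, within `2 * d`, and has squared norm `2`.
  have hsep (i j : Fin p) (hij : i ≠ j) : 2 * (√(n : ℝ) * (1 - δ')) ^ 2 ≤ ‖a i - a j‖ ^ 2 := by
    have h1 := le_norm_toEuclideanLin (X := X) (s := 2 * d) hn
      ((sparsity_sub_le (EuclideanSpace.single i 1) (EuclideanSpace.single j 1)).trans
        ((add_le_add (sparsity_single_le i) (sparsity_single_le j)).trans (by omega)))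
    have h2 : ‖(EuclideanSpace.single i 1 - EuclideanSpace.single j 1 :
        EuclideanSpace ℝ (Fin p))‖ ^ 2 = 2 := by
      rw [norm_sub_sq_real]
      simp [EuclideanSpace.inner_single_left, hij]
      norm_num
    rw [map_sub] at h1
    have h3 := pow_le_pow_left₀ (by positivity) h1 2
    rw [mul_pow, h2] at h3
    linarith
  let g : Fin d → EuclideanSpace ℝ (Fin n) → ℝ := fun k x =>
    Finset.univ.sup' Finset.univ_nonempty fun j => ⟪a (idx k j), x⟫
  set ℓ := √(Real.log ((p : ℝ) / (5 * d))) with hℓ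
  have hκ : 0 < √(n : ℝ) * (1 - δ') := mul_pos hn0 hpos
  have hg (k : Fin d) : σ * (√(n : ℝ) * (1 - δ')) * (ℓ / 4) ≤ ∫ x, g k x ∂μ := by
    have h1 := IsGaussian.le_integral_sup'_inner (μ := μ) (s := σ ^ 2)
      integral_id_multivariateGaussian (by positivity)
      (covarianceBilin_multivariateGaussian_smul_one σ) (a := fun j => a (idx k j))
      (fun j h0 => by
        have := ha (idx k j)
        rw [h0, norm_zero] at this
        linarith) hκ
      (fun i j hij => hsep _ _ fun h => hij (hidx h).2) (by simp; omega)
    rw [Real.sqrt_sq hσ.le, Fintype.card_fin] at h1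
    refine le_trans ?_ h1
    exact mul_le_mul_of_nonneg_left (log_div_five_mul_le hd hdp) (by positivity)
  have hgi (k : Fin d) : Integrable (fun ω => g k (ε ω)) P := by
    have h1 : Integrable (g k) μ := IsGaussian.integrable_sup'_inner _
    rw [← hε.map_eq] at h1
    exact h1.comp_aemeasurable hε.aemeasurable
  have hgP (k : Fin d) : ∫ ω, g k (ε ω) ∂P = ∫ x, g k x ∂μ :=
    hε.integral_comp (IsGaussian.integrable_sup'_inner _).aestronglyMeasurable
  have hpt : ∀ᵐ ω ∂P, ∑ k, g k (ε ω) ≤ √(n : ℝ) * lam * d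
      + √(n : ℝ) * (1 + δ) * √(d : ℝ) * ‖X.toEuclideanLin (βhat ω - βstar)‖ := by
    filter_upwards [hβhat] with ω hω
    have hmax (k : Fin d) : ∃ j, g k (ε ω) = ⟪a (idx k j), ε ω⟫ := by
      obtain ⟨j, -, hj⟩ := Finset.exists_mem_eq_sup' Finset.univ_nonempty
        fun j => ⟪a (idx k j), ε ω⟫
      exact ⟨j, hj⟩
    choose J hJ using hmax
    have hinj : Function.Injective fun k => idx k (J k) := fun k k' h => (hidx h).1
    -- One maximizing column per block: disjointness of the blocks makes `S` have exactly `d`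
    -- elements.
    set S : Finset (Fin p) := Finset.univ.image fun k => idx k (J k) with hS
    have hcard : S.card = d := by
      rw [hS, Finset.card_image_of_injective _ hinj, Finset.card_univ, Fintype.card_fin]
    have h1 := hω.inner_sub_le hconv (lassoPenalty_add_le hlam) (indicatorVector S)
    have h2 := norm_toEuclideanLin_le (X := X) (s := d) hn
      ((sparsity_indicatorVector S).trans hcard).le
    have h3 : ⟪ε ω, X.toEuclideanLin (indicatorVector S)⟫ = ∑ k, g k (ε ω) := by
      rw [indicatorVector, map_sum, inner_sum, hS, Finset.sum_image fun k _ k' _ h => hinj h]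
      exact Finset.sum_congr rfl fun k _ => by rw [hJ, real_inner_comm]
    rw [norm_indicatorVector, hcard] at h2
    rw [lassoPenalty_indicatorVector, hcard, h3] at h1
    have h4 := mul_le_mul_of_nonneg_right h2 (norm_nonneg (X.toEuclideanLin (βhat ω - βstar)))
    linarith
  have hE := integral_mono_ae (integrable_finsetSum _ fun k _ => hgi k)
    ((integrable_const _).add (hint.const_mul _)) hpt
  rw [integral_finsetSum _ fun k _ => hgi k, integral_add' (integrable_const _) (hint.const_mul _),
    integral_const, integral_const_mul (_ * _ * _), ← hI] at hE
  simp only [hgP, probReal_univ, one_smul] at hE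
  have hsum : d * (σ * (√(n : ℝ) * (1 - δ')) * (ℓ / 4)) ≤ ∑ k, ∫ x, g k x ∂μ := by
    have := Finset.sum_le_sum fun k (_ : k ∈ Finset.univ) => hg k
    simpa using this
  have hpen : √(n : ℝ) * lam * d ≤ √(n : ℝ) * ((1 - δ') / 8 * σ * ℓ) * d := by gcongr
  have hsd : √(d : ℝ) * √(d : ℝ) = d := Real.mul_self_sqrt hd0.le
  have hsd0 : 0 < √(d : ℝ) := Real.sqrt_pos.2 hd0
  -- The constant is `1/4 - 1/8`: the block maxima minus the largest allowed penalty.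
  have hfin : √(n : ℝ) * √(d : ℝ) * ((1 - δ') / 8 * σ * (√(d : ℝ) * ℓ))
      ≤ √(n : ℝ) * √(d : ℝ) * ((1 + δ) * I) := by
    have e : √(n : ℝ) * √(d : ℝ) * ((1 - δ') / 8 * σ * (√(d : ℝ) * ℓ))
        = √(n : ℝ) * ((1 - δ') / 8 * σ * ℓ) * (√(d : ℝ) * √(d : ℝ)) := by ring
    rw [e, hsd]
    linarith
  have hfin' := le_of_mul_le_mul_left hfin (by positivity)
  rw [Real.sqrt_mul hd0.le, ← hℓ]
  calc (1 - δ') / (8 * (1 + δ)) * σ * (√(d : ℝ) * ℓ)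
      = (1 - δ') / 8 * σ * (√(d : ℝ) * ℓ) / (1 + δ) := by field_simp
    _ ≤ I := by rw [div_le_iff₀ (by positivity)]; linarith
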